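/- Let $\mathfrak H$ and $\mathcal H$ be complex Hilbert spaces and let $A$ be a closed symmetric linear relation in $\mathfrak H$ (for instance a closed, not necessarily densely defined, symmetric operator, identified with its graph), that is, a closed linear subspace of $\mathfrak H\times\mathfrak H$ with $(f',f)\in\mathbb R$ for all $\{f,f'\}\in A$. Let $A^*=\{\{h,k\}\in\mathfrak H^2 : (k,f)=(h,g)\ \text{for all } \{f,g\}\in A\}$ be its adjoint relation and let $n_\pm(A)=\dim\{f\in\mathfrak H : \{f,\pm i f\}\in A^*\}$ be its defect numbers; here $\dim$ is the Hilbert space dimension (the cardinality of an orthonormal basis). Let $\Gamma$ be a boundary relation for $A^*$, that is, a linear subspace $\Gamma\subset\mathfrak H^2\times\mathcal H^2$ such that (G1) $\operatorname{dom}\Gamma=\{\hat f\in\mathfrak H^2 : \{\hat f,\hat h\}\in\Gamma \text{ for some } \hat h\in\mathcal H^2\}$ is a dense subspace of $A^*$, and $$(f',g)_{\mathfrak H}-(f,g')_{\mathfrak H}=(h',k)_{\mathcal H}-(h,k')_{\mathcal H}\qquad(*)$$ for all $\{\hat f,\hat h\},\{\hat g,\hat k\}\in\Gamma$, where $\hat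 f=\{f,f'\}$, $\hat h=\{h,h'\}$, $\hat g=\{g,g'\}$, $\hat k=\{k,k'\}$; (G2) if $\{\hat g,\hat k\}\in\mathfrak H^2\times\mathcal H^2$ satisfies $(*)$ for all $\{\hat f,\hat h\}\in\Gamma$, then $\{\hat g,\hat k\}\in\Gamma$. Let $\operatorname{mul}\Gamma=\{\hat h\in\mathcal H^2 : \{0,\hat h\}\in\Gamma\}$, a subspace of the Hilbert space $\mathcal H\oplus\mathcal H$. Then, for each choice of the sign $\pm$ in (i) and (ii): (i) $n_\pm(A)\le\dim\mathcal H$; (ii) if $n_\pm(A)<\infty$, then $\dim\mathcal H-n_\pm(A)=\dim\operatorname{mul}\Gamma$, i.e. $\dim\mathcal H=n_\pm(A)+\dim\operatorname{mul}\Gamma$; (iii) if $\dim\mathcal H<\infty$, then $n_+(A)=n_-(A)$. -/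

import Mathlib

open scoped Cardinal

universe u v w

namespace BoundaryRelation

section HilbertDimension

variable {E : Type u} [NormedAddCommGroup E] [InnerProductSpace ℂ E]

/-- The Hilbert space dimension of a complex Hilbert space: the cardinality of an orthonormal
(Hilbert) basis. It does not depend on the basis, see `lift_mk_eq_hilbertDim`. (This is not the
algebraic dimension, from which it differs in infinite dimensions.) -/
noncomputable def hilbertDim (E : Type u) [NormedAddCommGroup E] [InnerProductSpace ℂ E] :
    Cardinal.{u} :=
  sInf {c : Cardinal.{u} | ∃ ι : Type u, Nonempty (HilbertBasis ι ℂ E) ∧ #ι = c}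

theorem hilbertBasis_lift_mk_le {ι : Type v} {κ : Type w} (b : HilbertBasis ι ℂ E)
    (c : HilbertBasis κ ℂ E) : Cardinal.lift.{w} (#ι) ≤ Cardinal.lift.{v} (#κ) := by
  rcases finite_or_infinite κ with hκ | hκ
  · have := Fintype.ofFinite κ
    have h1 := b.orthonormal.linearIndependent.cardinal_lift_le_rank
    rw [rank_eq_card_basis c.toOrthonormalBasis.toBasis, Cardinal.lift_natCast,
      Cardinal.lift_le_nat_iff] at h1
    rwa [Cardinal.mk_fintype κ, Cardinal.lift_natCast, Cardinal.lift_le_nat_iff]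
  · have hcov : (⋃ k, {i | inner ℂ (b i) (c k) ≠ (0 : ℂ)}) = Set.univ := by
      refine Set.eq_univ_of_forall fun i => ?_
      by_contra hi
      simp only [Set.mem_iUnion, Set.mem_ofPred_eq, not_exists, not_not] at hi
      have h := c.hasSum_inner_mul_inner (b i) (b i)
      simp only [hi, zero_mul] at h
      have h0 := h.unique hasSum_zero
      rw [inner_self_eq_zero] at h0
      exact b.orthonormal.ne_zero i h0
    have hcount : ∀ k, {i | inner ℂ (b i) (c k) ≠ (0 : ℂ)}.Countable := by
      intro k
      have h := (b.summable_inner_mul_inner (c k) (c k)).countable_support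
      refine h.mono fun i hi => ?_
      simp only [Set.mem_ofPred_eq] at hi
      simp only [Function.mem_support, ne_eq, mul_eq_zero, not_or]
      exact ⟨fun h => hi (inner_eq_zero_symm.1 h), hi⟩
    have h := Cardinal.mk_iUnion_le_lift fun k => {i | inner ℂ (b i) (c k) ≠ (0 : ℂ)}
    rw [hcov, Cardinal.mk_univ] at h
    refine h.trans ?_
    have hinf : ℵ₀ ≤ Cardinal.lift.{v} (#κ) := by
      simp
    calc _ ≤ Cardinal.lift.{v} (#κ) * ℵ₀ := by
          gcongr
          exact ciSup_le' fun k => by simpa using hcount k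
      _ = _ := Cardinal.mul_aleph0_eq hinf

theorem lift_mk_eq_hilbertDim {ι : Type v} (b : HilbertBasis ι ℂ E) :
    Cardinal.lift.{u} (#ι) = Cardinal.lift.{v} (hilbertDim E) := by
  have hne : {c : Cardinal.{u} | ∃ ι : Type u, Nonempty (HilbertBasis ι ℂ E) ∧ #ι = c}.Nonempty := by
    let e : ι ≃ Set.range b := Equiv.ofInjective b b.orthonormal.linearIndependent.injective
    have : CompleteSpace E := b.repr.toIsometryEquiv.isometry.isUniformInducing.completeSpace_congr
      b.repr.surjective |>.2 inferInstance
    refine ⟨_, Set.range b, ⟨HilbertBasis.mk (v := fun x : Set.range b => (x : E)) ?_ ?_⟩, rfl⟩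
    · exact b.orthonormal.toSubtypeRange
    · rw [Subtype.range_coe]
      exact b.dense_span.ge
  obtain ⟨κ, ⟨c⟩, hc⟩ := csInf_mem hne
  have : hilbertDim E = #κ := hc.symm
  rw [this]
  exact le_antisymm (hilbertBasis_lift_mk_le b c) (hilbertBasis_lift_mk_le c b)

end HilbertDimension

section Relations

variable {E : Type u} [NormedAddCommGroup E] [InnerProductSpace ℂ E]

/-- A linear relation `T` in `E` (a linear subspace of `E × E`) is symmetric if `(h', h)` is real
for all `{h, h'} ∈ T`. -/
def IsSymmetric (T : Submodule ℂ (E × E)) : Prop :=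
  ∀ p ∈ T, (inner ℂ p.1 p.2 : ℂ).im = 0

/-- The null space `ker (T - z) = {f | {f, z f} ∈ T}` of a linear relation `T`. -/
def nullSpace (T : Submodule ℂ (E × E)) (z : ℂ) : Submodule ℂ E :=
  T.comap (LinearMap.prod LinearMap.id (z • LinearMap.id))

/-- The defect number `n₊(S) = dim ker (S* - i)`, where `S*` is the adjoint linear relation. -/
noncomputable def defectPlus (S : Submodule ℂ (E × E)) : Cardinal.{u} :=
  hilbertDim (nullSpace S.adjoint Complex.I)

/-- The defect number `n₋(S) = dim ker (S* + i)`, where `S*` is the adjoint linear relation. -/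
noncomputable def defectMinus (S : Submodule ℂ (E × E)) : Cardinal.{u} :=
  hilbertDim (nullSpace S.adjoint (-Complex.I))

end Relations

section BoundaryRelations

variable {H : Type u} [NormedAddCommGroup H] [InnerProductSpace ℂ H]
variable {K : Type v} [NormedAddCommGroup K] [InnerProductSpace ℂ K]

/-- The domain of a linear relation `Γ` from `H²` to `K²`. -/
def dom (Γ : Submodule ℂ ((H × H) × (K × K))) : Submodule ℂ (H × H) :=
  Γ.map (LinearMap.fst ℂ (H × H) (K × K))

/-- The multivalued part `{ĥ ∈ K² | {0, ĥ} ∈ Γ}` of a linear relation `Γ` from `H²` to `K²`,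
as a subspace of the Hilbert space `K ⊕ K`. -/
def mul (Γ : Submodule ℂ ((H × H) × (K × K))) : Submodule ℂ (WithLp 2 (K × K)) :=
  (Γ.comap (LinearMap.inr ℂ (H × H) (K × K))).comap
    (WithLp.linearEquiv 2 ℂ (K × K)).toLinearMap

/-- Green's identity `(f', g) - (f, g') = (h', k) - (h, k')` for the pairs `x = {f̂, ĥ}` and
`y = {ĝ, k̂}` in `H² × K²`. Here `(a, b)` is linear in `a`, so that it is `inner ℂ b a`. -/
def Green (x y : (H × H) × (K × K)) : Prop :=
  (inner ℂ y.1.1 x.1.2 - inner ℂ y.1.2 x.1.1 : ℂ) = inner ℂ y.2.1 x.2.2 - inner ℂ y.2.2 x.2.1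

/-- `Γ` is a boundary relation for `S*`, where `S` is a closed symmetric linear relation in `H`. -/
structure IsBoundaryRelation (S : Submodule ℂ (H × H))
    (Γ : Submodule ℂ ((H × H) × (K × K))) : Prop where
  isClosed : IsClosed (S : Set (H × H))
  isSymmetric : IsSymmetric S
  dom_le : dom Γ ≤ S.adjoint
  dense : (S.adjoint : Set (H × H)) ⊆ closure (dom Γ : Set (H × H))
  green : ∀ x ∈ Γ, ∀ y ∈ Γ, Green x y
  maximal : ∀ y : (H × H) × (K × K), (∀ x ∈ Γ, Green x y) → y ∈ Γ

end BoundaryRelations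

end BoundaryRelation

open BoundaryRelation

/-! Flipping the sign of `h'` turns `Γ` into a self-adjoint relation `Ã` in `H ⊕ K`, so for `z = ±i`
the map `shift z`, which is `Ã - z` up to sign, carries `Γ` bijectively onto `H ⊕ K`
(`bijective_shift`). Solving for the data `{0, v}` and keeping the component in `H` gives a bounded
operator `T : K → ker (A* - z)`, the γ-field.

The kernel of `T` is isometric to `mul Γ`, and its range is dense. Since a bounded operator with
dense range satisfies `dim K = dim (target) + dim ker T` (`hilbertDim_eq_add_ker`), this yields the
cardinal identity `dim K = n + dim mul Γ` for both signs (`lift_hilbertDim_eq`). Claims (i) and (ii)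
are read off from it, and (iii) follows by cancelling `dim mul Γ`. -/

namespace BoundaryRelation

/-! ### Hilbert space dimension and bounded operators -/

section HilbertDimension

variable {E : Type u} [NormedAddCommGroup E] [InnerProductSpace ℂ E]
variable {F : Type v} [NormedAddCommGroup F] [InnerProductSpace ℂ F]

theorem hilbertDim_congr [CompleteSpace E] (e : E ≃ₗᵢ[ℂ] F) :
    Cardinal.lift.{v} (hilbertDim E) = Cardinal.lift.{u} (hilbertDim F) := by
  obtain ⟨w, b, -⟩ := exists_hilbertBasis ℂ E
  have hE := lift_mk_eq_hilbertDim b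
  have hF := lift_mk_eq_hilbertDim (HilbertBasis.ofRepr (e.symm.trans b.repr))
  rw [Cardinal.lift_id, Cardinal.lift_id] at hE
  rw [← hE, hF]

/-- A bounded injective operator does not decrease the Hilbert space dimension. -/
theorem hilbertDim_le_of_injective [CompleteSpace E] [CompleteSpace F] (T : E →L[ℂ] F)
    (hT : Function.Injective T) :
    Cardinal.lift.{v} (hilbertDim E) ≤ Cardinal.lift.{u} (hilbertDim F) := by
  obtain ⟨ι, b, -⟩ := exists_hilbertBasis ℂ E
  obtain ⟨κ, c, -⟩ := exists_hilbertBasis ℂ F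
  have hE := lift_mk_eq_hilbertDim b
  have hF := lift_mk_eq_hilbertDim c
  rw [Cardinal.lift_id, Cardinal.lift_id] at hE hF
  rw [← hE, ← hF]
  rcases finite_or_infinite κ with hκ | hκ
  · have := Fintype.ofFinite κ
    have h1 := (b.orthonormal.linearIndependent.map' T.toLinearMap
      (LinearMap.ker_eq_bot.2 hT)).cardinal_lift_le_rank
    rw [rank_eq_card_basis c.toOrthonormalBasis.toBasis, Cardinal.lift_natCast,
      Cardinal.lift_le_nat_iff] at h1
    rwa [Cardinal.mk_fintype κ, Cardinal.lift_natCast, Cardinal.lift_le_nat_iff]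
  -- Each `T (b i) ≠ 0` has a nonzero coefficient against some `c k`, while each `c k` serves only
  -- countably many `i`, because `T* (c k)` has square-summable coefficients. Hence `#ι ≤ #κ * ℵ₀ =
  -- #κ`.
  · have hcov : (⋃ k, {i | inner ℂ (T (b i)) (c k) ≠ (0 : ℂ)}) = Set.univ := by
      refine Set.eq_univ_of_forall fun i => ?_
      by_contra hi
      simp only [Set.mem_iUnion, Set.mem_ofPred_eq, not_exists, not_not] at hi
      have h := c.hasSum_inner_mul_inner (T (b i)) (T (b i))
      simp only [hi, zero_mul] at h
      have h0 := h.unique hasSum_zero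
      rw [inner_self_eq_zero] at h0
      exact b.orthonormal.ne_zero i (hT (h0.trans (map_zero T).symm))
    have hcount : ∀ k, {i | inner ℂ (T (b i)) (c k) ≠ (0 : ℂ)}.Countable := by
      intro k
      have h := (b.summable_inner_mul_inner (T.adjoint (c k)) (T.adjoint (c k))).countable_support
      refine h.mono fun i hi => ?_
      simp only [Set.mem_ofPred_eq] at hi
      rw [← ContinuousLinearMap.adjoint_inner_right] at hi
      simp only [Function.mem_support, ne_eq, mul_eq_zero, not_or]
      exact ⟨fun h => hi (inner_eq_zero_symm.1 h), hi⟩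
    have h := Cardinal.mk_iUnion_le_lift fun k => {i | inner ℂ (T (b i)) (c k) ≠ (0 : ℂ)}
    rw [hcov, Cardinal.mk_univ] at h
    refine h.trans ?_
    have hinf : ℵ₀ ≤ Cardinal.lift.{u} (#κ) := by
      simp
    calc _ ≤ Cardinal.lift.{u} (#κ) * ℵ₀ := by
          gcongr
          exact ciSup_le' fun k => by simpa using hcount k
      _ = _ := Cardinal.mul_aleph0_eq hinf

theorem hilbertDim_eq_add_orthogonal [CompleteSpace E] (U : Submodule ℂ E) [CompleteSpace U] :
    hilbertDim E = hilbertDim U + hilbertDim Uᗮ := by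
  obtain ⟨ι, b, -⟩ := exists_hilbertBasis ℂ U
  obtain ⟨κ, c, -⟩ := exists_hilbertBasis ℂ Uᗮ
  let v : ι ⊕ κ → E := Sum.elim (fun i => (b i : E)) (fun k => (c k : E))
  have hv : Orthonormal ℂ v := by
    have hb := b.orthonormal.comp_linearIsometry U.subtypeₗᵢ
    have hc := c.orthonormal.comp_linearIsometry Uᗮ.subtypeₗᵢ
    refine ⟨?_, ?_⟩
    · rintro (i | k)
      · exact hb.1 i
      · exact hc.1 k
    · rintro (i | i) (k | k) hik
      · exact hb.2 fun h => hik (congrArg _ h)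
      · exact (Submodule.mem_orthogonal _ _).1 (c k).2 _ (b i).2
      · exact (Submodule.mem_orthogonal' _ _).1 (c i).2 _ (b k).2
      · exact hc.2 fun h => hik (congrArg _ h)
  have hsp : (Submodule.span ℂ (Set.range v))ᗮ = ⊥ := by
    rw [Submodule.eq_bot_iff]
    intro x hx
    have hx' : ∀ j, inner ℂ (v j) x = 0 := fun j =>
      (Submodule.mem_orthogonal _ _).1 hx _ (Submodule.subset_span ⟨j, rfl⟩)
    have key : ∀ (W : Submodule ℂ E) (γ : Type u) (d : HilbertBasis γ ℂ W),
        (∀ j, inner ℂ (d j : E) x = 0) → x ∈ Wᗮ := by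
      intro W γ d hd
      have hle : (⊤ : Submodule ℂ W) ≤ LinearMap.ker
          ((innerSL ℂ x).comp W.subtypeL).toLinearMap := by
        rw [← d.dense_span]
        refine Submodule.topologicalClosure_minimal _ ?_
          (ContinuousLinearMap.isClosed_ker ((innerSL ℂ x).comp W.subtypeL))
        rw [Submodule.span_le]
        rintro _ ⟨j, rfl⟩
        exact inner_eq_zero_symm.1 (hd j)
      rw [Submodule.mem_orthogonal']
      intro u hu
      exact hle (Submodule.mem_top (x := ⟨u, hu⟩))
    have h1 := key U ι b fun j => hx' (Sum.inl j)
    have h2 := key Uᗮ κ c fun j => hx' (Sum.inr j)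
    exact inner_self_eq_zero.1 ((Submodule.mem_orthogonal _ _).1 h2 x h1)
  have h := lift_mk_eq_hilbertDim (HilbertBasis.mkOfOrthogonalEqBot hv hsp)
  have hb := lift_mk_eq_hilbertDim b
  have hc := lift_mk_eq_hilbertDim c
  simp only [Cardinal.lift_id] at h hb hc
  rw [← h, ← hb, ← hc]
  simp

/-- `dim E = dim F + dim ker T` for a bounded operator `T : E → F` with dense range. -/
theorem hilbertDim_eq_add_ker [CompleteSpace E] [CompleteSpace F] (T : E →L[ℂ] F)
    (hT : ∀ y, (∀ x, inner ℂ (T x) y = 0) → y = 0) :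
    Cardinal.lift.{v} (hilbertDim E) = Cardinal.lift.{u} (hilbertDim F) +
      Cardinal.lift.{v} (hilbertDim (LinearMap.ker T.toLinearMap)) := by
  have hcl : IsClosed (LinearMap.ker T.toLinearMap : Set E) := T.isClosed_ker
  have : CompleteSpace (LinearMap.ker T.toLinearMap) := hcl.completeSpace_coe
  rw [hilbertDim_eq_add_orthogonal (LinearMap.ker T.toLinearMap), Cardinal.lift_add, add_comm]
  congr 1
  -- `T` is injective on `(ker T)ᗮ`. Conversely, `T*` maps into `(ker T)ᗮ` and is injective because
  -- the range of `T` is dense.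
  refine le_antisymm ?_ ?_
  · refine hilbertDim_le_of_injective (T.comp (LinearMap.ker T.toLinearMap)ᗮ.subtypeL) ?_
    rw [injective_iff_map_eq_zero]
    intro x hx
    exact Subtype.ext (inner_self_eq_zero.1 ((Submodule.mem_orthogonal _ _).1 x.2 x hx))
  · refine hilbertDim_le_of_injective
      (T.adjoint.codRestrict (LinearMap.ker T.toLinearMap)ᗮ fun y => ?_) ?_
    · rw [Submodule.mem_orthogonal]
      intro x hx
      have hx' : T x = 0 := hx
      rw [ContinuousLinearMap.adjoint_inner_right, hx', inner_zero_left]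
    · rw [injective_iff_map_eq_zero]
      intro y hy
      refine hT y fun x => ?_
      have hy' : T.adjoint y = 0 := congrArg Subtype.val hy
      rw [← ContinuousLinearMap.adjoint_inner_right, hy', inner_zero_right]

end HilbertDimension

section Relations

variable {E : Type u} [NormedAddCommGroup E] [InnerProductSpace ℂ E]

theorem isClosed_nullSpace_adjoint (S : Submodule ℂ (E × E)) (z : ℂ) :
    IsClosed (nullSpace S.adjoint z : Set E) := by
  have : (nullSpace S.adjoint z : Set E) =
      ⋂ p ∈ S, {f | inner ℂ p.2 f - inner ℂ p.1 (z • f) = (0 : ℂ)} := by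
    ext f
    simp [nullSpace, inner_smul_right]
  rw [this]
  exact isClosed_biInter fun p _ => isClosed_eq (by fun_prop) continuous_const

end Relations

/-! ### The shifted boundary relation and its norm identity -/

section BoundaryRelations

variable {H : Type u} [NormedAddCommGroup H] [InnerProductSpace ℂ H]
variable {K : Type v} [NormedAddCommGroup K] [InnerProductSpace ℂ K]

/-- The operator `{f̂, ĥ} ↦ {f' - z f, h' + z h}` on `H² × K²`; on a boundary relation it is
`Ã - z` for the self-adjoint relation `Ã = {{{f, h}, {f', -h'}}}`, up to a sign. -/
noncomputable def shift (z : ℂ) : ((H × H) × (K × K)) →L[ℂ] WithLp 2 (H × K) :=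
  (WithLp.prodContinuousLinearEquiv 2 ℂ H K).symm.toContinuousLinearMap.comp
    (((ContinuousLinearMap.snd ℂ H H - z • ContinuousLinearMap.fst ℂ H H).comp
        (ContinuousLinearMap.fst ℂ (H × H) (K × K))).prod
      ((ContinuousLinearMap.snd ℂ K K + z • ContinuousLinearMap.fst ℂ K K).comp
        (ContinuousLinearMap.snd ℂ (H × H) (K × K))))

@[simp]
theorem shift_apply (z : ℂ) (x : (H × H) × (K × K)) :
    shift z x = WithLp.toLp 2 (x.1.2 - z • x.1.1, x.2.2 + z • x.2.1) := rfl

variable {S : Submodule ℂ (H × H)} {Γ : Submodule ℂ ((H × H) × (K × K))} {z : ℂ}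

/-- The cross terms on the left add up to a multiple of Green's identity for `x` with itself, hence
cancel; `z * conj z = 1` does the rest. -/
theorem norm_sq_shift (hz : star z = -z) (hz' : z * z = -1) {x : (H × H) × (K × K)}
    (hx : Green x x) :
    ‖x.1.2 - z • x.1.1‖ ^ 2 + ‖x.2.2 + z • x.2.1‖ ^ 2 =
      ‖x.1.1‖ ^ 2 + ‖x.1.2‖ ^ 2 + ‖x.2.1‖ ^ 2 + ‖x.2.2‖ ^ 2 := by
  have hc : (starRingEnd ℂ) z = -z := hz
  apply Complex.ofReal_injective
  push_cast
  have hn : ∀ {E : Type _} [NormedAddCommGroup E] [InnerProductSpace ℂ E] (a : E),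
      ((‖a‖ : ℂ)) ^ 2 = inner ℂ a a := fun a => (inner_self_eq_norm_sq_to_K a).symm
  -- A second copy, since a local statement is fixed to one universe: `hn` serves `H`, `hn'` serves
  -- `K`.
  have hn' : ∀ {E : Type _} [NormedAddCommGroup E] [InnerProductSpace ℂ E] (a : E),
      ((‖a‖ : ℂ)) ^ 2 = inner ℂ a a := fun a => (inner_self_eq_norm_sq_to_K a).symm
  unfold Green at hx
  rw [hn (x.1.2 - z • x.1.1), hn' (x.2.2 + z • x.2.1), hn x.1.1, hn x.1.2, hn' x.2.1, hn' x.2.2]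
  simp only [inner_sub_left, inner_sub_right, inner_add_left, inner_add_right, inner_smul_left,
    inner_smul_right, hc]
  linear_combination z * hx - (inner ℂ x.1.1 x.1.1 + inner ℂ x.2.1 x.2.1) * hz'

theorem isClosed_boundaryRelation (hΓ : IsBoundaryRelation S Γ) :
    IsClosed (Γ : Set ((H × H) × (K × K))) := by
  have : (Γ : Set ((H × H) × (K × K))) = ⋂ x ∈ Γ, {y | Green x y} := by
    ext y
    simp only [Set.mem_iInter]
    exact ⟨fun hy x hx => hΓ.green x hx y hy, fun hy => hΓ.maximal y hy⟩
  rw [this]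
  unfold Green
  exact isClosed_biInter fun x _ => isClosed_eq (by fun_prop) (by fun_prop)

theorem norm_le_norm_shift (hΓ : IsBoundaryRelation S Γ) (hz : star z = -z) (hz' : z * z = -1)
    (x : Γ) : ‖x‖ ≤ ‖shift z (x : (H × H) × (K × K))‖ := by
  have h := norm_sq_shift hz hz' (hΓ.green x x.2 x x.2)
  set w := shift z (x : (H × H) × (K × K))
  have h2 : ‖w‖ ^ 2 = ‖x.1.1.2 - z • x.1.1.1‖ ^ 2 + ‖x.1.2.2 + z • x.1.2.1‖ ^ 2 :=
    WithLp.prod_norm_sq_eq_of_L2 w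
  rw [h] at h2
  have hle : ∀ a : ℝ, a ^ 2 ≤ ‖w‖ ^ 2 → a ≤ ‖w‖ := fun a ha => le_of_sq_le_sq ha (norm_nonneg _)
  have h11 := sq_nonneg ‖x.1.1.1‖
  have h12 := sq_nonneg ‖x.1.1.2‖
  have h21 := sq_nonneg ‖x.1.2.1‖
  have h22 := sq_nonneg ‖x.1.2.2‖
  rw [← Submodule.norm_coe, Prod.norm_def, Prod.norm_def, Prod.norm_def]
  refine max_le (max_le ?_ ?_) (max_le ?_ ?_) <;> refine hle _ ?_ <;> rw [h2] <;> linarith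

/-- If `{f̂, 0} ∈ Γ` and `Γ` is a boundary relation for `S*`, then `f̂ ∈ S**`. -/
theorem mem_adjoint_adjoint (hΓ : IsBoundaryRelation S Γ) {p : H × H}
    (hp : (p, (0 : K × K)) ∈ Γ) : p ∈ S.adjoint.adjoint := by
  have hcl : IsClosed {q : H × H | inner ℂ q.2 p.1 - inner ℂ q.1 p.2 = (0 : ℂ)} :=
    isClosed_eq (by fun_prop) continuous_const
  have hdom : (dom Γ : Set (H × H)) ⊆ {q | inner ℂ q.2 p.1 - inner ℂ q.1 p.2 = (0 : ℂ)} := by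
    rintro _ ⟨y, hy, rfl⟩
    have h := hΓ.green _ hp _ hy
    simp only [Green, Prod.fst_zero, Prod.snd_zero, inner_zero_right, sub_zero] at h
    simp only [Set.mem_ofPred_eq, LinearMap.fst_apply]
    linear_combination -h
  rw [Submodule.mem_adjoint_iff]
  exact fun a b hab => closure_minimal hdom hcl (hΓ.dense hab)

/-! ### Bijectivity of the shift, the γ-field and the dimension identity -/

variable [CompleteSpace H] [CompleteSpace K]

/-- Being bounded below, the map is injective with closed range; a vector orthogonal to the range
would produce an element of `Γ` killed by `shift (-z)`, which is bounded below too. -/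
theorem bijective_shift (hΓ : IsBoundaryRelation S Γ) (hz : star z = -z) (hz' : z * z = -1) :
    Function.Bijective ((shift z).comp Γ.subtypeL) := by
  have : CompleteSpace Γ := (isClosed_boundaryRelation hΓ).completeSpace_coe
  have hanti : AntilipschitzWith 1 ((shift z).comp Γ.subtypeL) :=
    ContinuousLinearMap.antilipschitz_of_bound _ fun x => by
      simpa using norm_le_norm_shift hΓ hz hz' x
  refine ⟨hanti.injective, ?_⟩
  have hcl : IsClosed (LinearMap.range ((shift z).comp Γ.subtypeL).toLinearMap :
      Set (WithLp 2 (H × K))) :=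
    hanti.isClosed_range ((shift z).comp Γ.subtypeL).uniformContinuous
  have : CompleteSpace (LinearMap.range ((shift z).comp Γ.subtypeL).toLinearMap) :=
    hcl.completeSpace_coe
  have hrange : LinearMap.range ((shift z).comp Γ.subtypeL).toLinearMap = ⊤ := by
    rw [← Submodule.orthogonal_eq_bot_iff, Submodule.eq_bot_iff]
    intro w hw
    have hc : (starRingEnd ℂ) z = -z := hz
    -- For this element, Green's identity against `x` is exactly the orthogonality of `w` to `shift
    -- z x`, so (G2) applies.
    have hy : (((w.fst, -z • w.fst), (-w.snd, -z • w.snd)) : (H × H) × (K × K)) ∈ Γ := by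
      refine hΓ.maximal _ fun x hx => ?_
      have h := (Submodule.mem_orthogonal' _ _).1 hw _ ⟨⟨x, hx⟩, rfl⟩
      simp [WithLp.prod_inner_apply, inner_sub_right, inner_add_right, inner_smul_right] at h
      simp only [Green, inner_neg_left, inner_smul_left, map_neg, hc, neg_neg]
      linear_combination h
    have h := norm_le_norm_shift hΓ (z := -z) (by rw [star_neg, hz]) (by rw [neg_mul_neg, hz'])
      ⟨_, hy⟩
    have h0 : shift (-z) (((w.fst, -z • w.fst), (-w.snd, -z • w.snd)) : (H × H) × (K × K)) = 0 := by
      simp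
    rw [h0, norm_zero, norm_le_zero_iff, Submodule.mk_eq_zero, Prod.mk_eq_zero, Prod.mk_eq_zero,
      Prod.mk_eq_zero, neg_eq_zero] at h
    exact WithLp.ofLp_injective 2 (Prod.ext h.1.1 h.2.1)
  exact LinearMap.range_eq_top.1 hrange

/-- The component in `H` of the inverse of `shift z` on `{0} × K`, a bounded operator from `K`
into the defect subspace `ker (S* - z)`. -/
theorem exists_gammaField (hΓ : IsBoundaryRelation S Γ) (hz : star z = -z) (hz' : z * z = -1) :
    ∃ (R : K →ₗ[ℂ] (H × H) × (K × K)) (T : K →L[ℂ] nullSpace S.adjoint z),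
      (∀ v, R v ∈ Γ ∧ (R v).1.2 = z • (R v).1.1 ∧ (R v).2.2 + z • (R v).2.1 = v) ∧
        ∀ v, (T v : H) = (R v).1.1 := by
  have : CompleteSpace Γ := (isClosed_boundaryRelation hΓ).completeSpace_coe
  have hb := bijective_shift hΓ hz hz'
  let e := ContinuousLinearEquiv.ofBijective ((shift z).comp Γ.subtypeL)
    (LinearMap.ker_eq_bot.2 hb.1) (LinearMap.range_eq_top.2 hb.2)
  let R : K →L[ℂ] (H × H) × (K × K) := (Γ.subtypeL.comp e.symm.toContinuousLinearMap).comp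
    ((WithLp.prodContinuousLinearEquiv 2 ℂ H K).symm.toContinuousLinearMap.comp
      (ContinuousLinearMap.inr ℂ H K))
  have hR : ∀ v, R v ∈ Γ ∧ (R v).1.2 = z • (R v).1.1 ∧ (R v).2.2 + z • (R v).2.1 = v := by
    intro v
    have h : shift z (R v) = WithLp.toLp 2 ((0 : H), v) :=
      e.apply_symm_apply (WithLp.toLp 2 ((0 : H), v))
    rw [shift_apply] at h
    have h' := Prod.ext_iff.1 (WithLp.toLp_injective 2 h)
    exact ⟨(e.symm _).2, sub_eq_zero.1 h'.1, h'.2⟩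
  refine ⟨R.toLinearMap, (((ContinuousLinearMap.fst ℂ H H).comp
    (ContinuousLinearMap.fst ℂ (H × H) (K × K))).comp R).codRestrict _ fun v => ?_,
    hR, fun v => rfl⟩
  obtain ⟨h1, h2, -⟩ := hR v
  have h3 : (R v).1 ∈ S.adjoint := hΓ.dom_le ⟨_, h1, rfl⟩
  have h4 : (R v).1 = ((R v).1.1, z • (R v).1.1) := Prod.ext rfl h2
  rw [h4] at h3
  exact h3

theorem lift_hilbertDim_eq (hΓ : IsBoundaryRelation S Γ) (hz : star z = -z) (hz' : z * z = -1) :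
    Cardinal.lift.{u} (hilbertDim K) =
      Cardinal.lift.{v} (hilbertDim (nullSpace S.adjoint z)) +
        Cardinal.lift.{u} (hilbertDim (mul Γ)) := by
  have hc : (starRingEnd ℂ) z = -z := hz
  obtain ⟨R, T, hR, hT⟩ := exists_gammaField hΓ hz hz'
  have : CompleteSpace (nullSpace S.adjoint z) :=
    (isClosed_nullSpace_adjoint S z).completeSpace_coe
  have hker : IsClosed (LinearMap.ker T.toLinearMap : Set K) := T.isClosed_ker
  have : CompleteSpace (LinearMap.ker T.toLinearMap) := hker.completeSpace_coe
  rw [hilbertDim_eq_add_ker T]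
  · congr 2
    -- `v ↦ ĥ`, where `{0, ĥ}` is the value of `R` at `v ∈ ker T`
    have hR0 : ∀ v : LinearMap.ker T.toLinearMap, (R v).1 = 0 := by
      intro v
      have h0 : T (v : K) = 0 := v.2
      have h1 : (R v).1.1 = 0 := by rw [← hT, h0]; rfl
      exact Prod.ext h1 (by rw [(hR v).2.1, h1, smul_zero]; rfl)
    let φ : LinearMap.ker T.toLinearMap →ₗ[ℂ] mul Γ :=
      (((WithLp.linearEquiv 2 ℂ (K × K)).symm.toLinearMap ∘ₗ
        LinearMap.snd ℂ (H × H) (K × K) ∘ₗ R) ∘ₗ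
          (LinearMap.ker T.toLinearMap).subtype).codRestrict (mul Γ) fun v => by
        change ((0 : H × H), (R v).2) ∈ Γ
        rw [← hR0 v]
        exact (hR v).1
    let φi : LinearMap.ker T.toLinearMap →ₗᵢ[ℂ] mul Γ := ⟨φ, fun v => by
      have h1 : ‖φ v‖ ^ 2 = ‖(R v).2.1‖ ^ 2 + ‖(R v).2.2‖ ^ 2 :=
        WithLp.prod_norm_sq_eq_of_L2 (WithLp.toLp 2 (R v).2)
      have h2 := norm_sq_shift hz hz' (hΓ.green _ (hR v).1 _ (hR v).1)
      rw [(hR v).2.2, hR0 v] at h2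
      have h3 : ‖φ v‖ ^ 2 = ‖v‖ ^ 2 := by
        rw [h1, ← Submodule.norm_coe v]
        simpa using h2.symm
      exact (pow_left_inj₀ (norm_nonneg _) (norm_nonneg _) two_ne_zero).1 h3⟩
    have hφ : Function.Surjective φi := by
      intro h
      have hΓh : ((0 : H × H), WithLp.ofLp (h : WithLp 2 (K × K))) ∈ Γ := h.2
      set k := WithLp.ofLp (h : WithLp 2 (K × K)) with hk
      -- The preimage of `k` is forced: it is the `K`-component of `shift z (0, k)`.
      have hRv : R (k.2 + z • k.1) = (0, k) := by
        have hinj := (bijective_shift hΓ hz hz').1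
        have hs : shift z (R (k.2 + z • k.1)) = shift z ((0 : H × H), k) := by
          obtain ⟨-, h1, h2⟩ := hR (k.2 + z • k.1)
          rw [shift_apply, shift_apply, h1, h2]
          simp
        have := @hinj ⟨_, (hR (k.2 + z • k.1)).1⟩ ⟨_, hΓh⟩ hs
        exact congrArg Subtype.val this
      have hv : k.2 + z • k.1 ∈ LinearMap.ker T.toLinearMap := by
        change T _ = 0
        apply Subtype.ext
        rw [hT, hRv]
        rfl
      refine ⟨⟨_, hv⟩, Subtype.ext ?_⟩
      change WithLp.toLp 2 (R (k.2 + z • k.1)).2 = _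
      rw [hRv, hk]
    have h := hilbertDim_congr (LinearIsometryEquiv.ofSurjective φi hφ)
    rwa [Cardinal.lift_id, Cardinal.lift_id] at h
  · intro g hg
    -- Density of the range: for `g` orthogonal to it, solve `shift (-z) x = (g, 0)` in `Γ`. It will
    -- turn out that `x = {f̂, 0}`, hence `f̂ ∈ S**`, which forces `g = 0`.
    obtain ⟨⟨x, hx⟩, hxg⟩ := (bijective_shift hΓ (z := -z) (by rw [star_neg, hz])
      (by rw [neg_mul_neg, hz'])).2 (WithLp.toLp 2 ((g : H), (0 : K)))
    change shift (-z) x = _ at hxg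
    rw [shift_apply] at hxg
    have hx' := Prod.ext_iff.1 (WithLp.toLp_injective 2 hxg)
    have hxH : x.1.2 = g - z • x.1.1 := by
      have : x.1.2 - (-z) • x.1.1 = g := hx'.1
      rw [← this, neg_smul, sub_neg_eq_add, add_sub_cancel_right]
    have hxK : x.2.2 = z • x.2.1 := by
      have : x.2.2 + (-z) • x.2.1 = 0 := hx'.2
      rwa [neg_smul, ← sub_eq_add_neg, sub_eq_zero] at this
    -- Test `x` against `R` at `x.2.1` itself: as `g` is orthogonal to the range of `T`, the
    -- `H`-side of Green's identity vanishes and the `K`-side is `-‖x.2.1‖²`.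
    have h0 : x.2.1 = 0 := by
      set y := R x.2.1 with hy
      obtain ⟨hy1, hy2, hy3⟩ := hR x.2.1
      have hgreen := hΓ.green x hx _ hy1
      have hgy : inner ℂ y.1.1 (g : H) = (0 : ℂ) := by
        rw [hy, ← hT]
        exact hg x.2.1
      rw [← hy] at hgreen hy2 hy3
      rw [Green, hy2, hxH, hxK] at hgreen
      simp only [inner_sub_right, inner_smul_left, inner_smul_right, hc, hgy] at hgreen
      have h3 : inner ℂ (y.2.2 + z • y.2.1) x.2.1 = (0 : ℂ) := by
        rw [inner_add_left, inner_smul_left, hc]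
        linear_combination hgreen
      rw [hy3] at h3
      exact inner_self_eq_zero.1 h3
    have hx0 : (x.1, (0 : K × K)) ∈ Γ := by
      have : x.2 = 0 := Prod.ext h0 (by rw [hxK, h0, smul_zero]; rfl)
      rwa [← this]
    -- Pairing `{f, g - z f} ∈ S**` with `{g, z g} ∈ S*` leaves only `-‖g‖² = 0`.
    have hA := (Submodule.mem_adjoint_iff _ _).1 (mem_adjoint_adjoint hΓ hx0) _ _ g.2
    simp only [LinearMap.id_apply, LinearMap.smul_apply, inner_smul_left, hc, hxH, inner_sub_right,
      inner_smul_right] at hA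
    refine Subtype.ext (inner_self_eq_zero (𝕜 := ℂ).1 ?_)
    linear_combination -hA

end BoundaryRelations

end BoundaryRelation

theorem corollary3p5 {H : Type u} [NormedAddCommGroup H] [InnerProductSpace ℂ H] [CompleteSpace H]
    {K : Type v} [NormedAddCommGroup K] [InnerProductSpace ℂ K] [CompleteSpace K]
    (A : Submodule ℂ (H × H)) (Γ : Submodule ℂ ((H × H) × (K × K)))
    (hΓ : IsBoundaryRelation A Γ) :
    -- (i)
    (Cardinal.lift.{v} (defectPlus A) ≤ Cardinal.lift.{u} (hilbertDim K) ∧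
      Cardinal.lift.{v} (defectMinus A) ≤ Cardinal.lift.{u} (hilbertDim K)) ∧
    -- (ii), with the subtraction of the finite cardinal `n` written as an addition
    ((defectPlus A < ℵ₀ → Cardinal.lift.{u} (hilbertDim K) =
        Cardinal.lift.{v} (defectPlus A) + Cardinal.lift.{u} (hilbertDim (mul Γ))) ∧
      (defectMinus A < ℵ₀ → Cardinal.lift.{u} (hilbertDim K) =
        Cardinal.lift.{v} (defectMinus A) + Cardinal.lift.{u} (hilbertDim (mul Γ)))) ∧
    -- (iii)
    (hilbertDim K < ℵ₀ → defectPlus A = defectMinus A) := by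
  have hp : Cardinal.lift.{u} (hilbertDim K) =
      Cardinal.lift.{v} (defectPlus A) + Cardinal.lift.{u} (hilbertDim (mul Γ)) :=
    lift_hilbertDim_eq hΓ Complex.conj_I Complex.I_mul_I
  have hm : Cardinal.lift.{u} (hilbertDim K) =
      Cardinal.lift.{v} (defectMinus A) + Cardinal.lift.{u} (hilbertDim (mul Γ)) :=
    lift_hilbertDim_eq hΓ (by rw [star_neg]; exact congrArg _ Complex.conj_I)
      (by rw [neg_mul_neg, Complex.I_mul_I])
  refine ⟨⟨hp ▸ self_le_add_right _ _, hm ▸ self_le_add_right _ _⟩,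
    ⟨fun _ => hp, fun _ => hm⟩, fun hK => ?_⟩
  -- Cancelling a cardinal summand requires it to be finite.
  have hfin : Cardinal.lift.{u} (hilbertDim (mul Γ)) < ℵ₀ :=
    (hp ▸ self_le_add_left _ _ : _ ≤ Cardinal.lift.{u} (hilbertDim K)).trans_lt
      (Cardinal.lift_lt_aleph0.2 hK)
  exact Cardinal.lift_injective
    ((Cardinal.add_right_inj_of_lt_aleph0 hfin).1 (hp.symm.trans hm))
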